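/- All posets carry the Scott topology unless stated otherwise. A domain is a continuous DCPO (a poset in which every nonempty directed set has a join and every element is the directed join of the elements way below it); it is coherent if the intersection of any two compact saturated subsets is compact, and zero-dimensional if its Scott topology has a basis of clopen sets. For a topological space $X$, $V(X)$ is the set of continuous valuations on $X$, i.e. of maps $\mu:\mathcal O(X)\to[0,\infty]$ that satisfy $\mu(\emptyset)=0$, are monotone, satisfy $\mu(U)+\mu(V)=\mu(U\cup V)+\mu(U\cap V)$, and preserve directed unions; it is ordered pointwise and is a real-cone under pointwise addition and pointwise scaling by non-negative reals. Put $V_{\le 1}(X)=\{\mu\in V(X)\mid \mu(X)\le 1\}$. Let $(X_i)_{i\in I}$ be a family of zero-dimensional coherent domains and let $F\subseteq\prod_{i\in I}V_{\le 1}(X_i)\subseteq\prod_{i\in I}V(X_i)$ be a finite set, where the product has the componentwise order and operations. Let $\mathrm{conv}\,F=\{\sum_k p_k\cdot a_k\mid \sum_k p_k=1,\ p_k\ge 0,\ a_k\in F\}$ (finite sums) be the convex closure of $F$, let $\overline{A}$ denote the Scott closure of $A\subseteq\prod_{i\in I}V(X_i)$, let $\mathord{\downarrow}A$ and $\mathord{\uparrow}A$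 denote its downward and upward closures, and put $b(F)=\overline{\mathrm{conv}\,F}\cap\mathord{\uparrow}\,\mathrm{conv}\,F$. Then: 1. $\mathrm{conv}\,F$ is compact in the Lawson topology of $\prod_{i\in I}V(X_i)$ (the topology generated by the Scott-open sets and the complements of the sets $\mathord{\uparrow}x$); 2. $\overline{\mathrm{conv}\,F}=\mathord{\downarrow}\,\mathrm{conv}\,F$; 3. $b(F)=\mathord{\downarrow}\,\mathrm{conv}\,F\cap\mathord{\uparrow}\,\mathrm{conv}\,F$. -/

import Mathlib

open Set TopologicalSpace Topology
open scoped ENNReal NNReal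

/-! ### Domains and their topologies -/

section Domains

/-- A DCPO: every (nonempty) directed set has a join. No bottom element is required. -/
def IsDCPO (X : Type*) [PartialOrder X] : Prop :=
  ∀ D : Set X, D.Nonempty → DirectedOn (· ≤ ·) D → ∃ x, IsLUB D x

/-- The way-below relation `x ≪ y`. -/
def WayBelow {X : Type*} [PartialOrder X] (x y : X) : Prop :=
  ∀ D : Set X, D.Nonempty → DirectedOn (· ≤ ·) D → ∀ z, IsLUB D z → y ≤ z → ∃ d ∈ D, x ≤ d

/-- A domain: a DCPO which is continuous, i.e. every element is the directed join of the
elements way below it. -/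
structure IsContinuousDomain (X : Type*) [PartialOrder X] : Prop where
  dcpo : IsDCPO X
  nonempty_wayBelow : ∀ x : X, {y | WayBelow y x}.Nonempty
  directedOn_wayBelow : ∀ x : X, DirectedOn (· ≤ ·) {y | WayBelow y x}
  isLUB_wayBelow : ∀ x : X, IsLUB {y | WayBelow y x} x

/-- A subset of a topological space is saturated if it is the intersection of its open
neighbourhoods. -/
def IsSaturated {X : Type*} [TopologicalSpace X] (K : Set X) : Prop :=
  ⋂₀ {U : Set X | IsOpen U ∧ K ⊆ U} = K

/-- A coherent domain, with respect to the given topology on `X`, which is meant to be the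
Scott topology: the intersection of any two compact saturated sets is compact. -/
structure IsCoherentDomain (X : Type*) [PartialOrder X] [TopologicalSpace X] : Prop
    extends IsContinuousDomain X where
  isCompact_inter : ∀ K L : Set X, IsCompact K → IsSaturated K → IsCompact L → IsSaturated L →
    IsCompact (K ∩ L)

/-- A topological space is zero-dimensional if it has a basis of clopen sets. -/
def IsZeroDimensional (X : Type*) [TopologicalSpace X] : Prop :=
  ∃ B : Set (Set X), IsTopologicalBasis B ∧ ∀ U ∈ B, IsClopen U

/-- The closure of a subset of a partially ordered set in the Scott topology. -/
def scottClosure {C : Type*} [PartialOrder C] (A : Set C) : Set C :=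
  @closure C (Topology.scott C univ) A

/-- Compactness of a subset of a partially ordered set in the Lawson topology. -/
def IsLawsonCompact {C : Type*} [PartialOrder C] (A : Set C) : Prop :=
  @IsCompact C (Topology.lawson C) A

end Domains

/-! ### Continuous valuations -/

/-- A continuous valuation on a topological space. -/
@[ext]
structure ContinuousValuation (X : Type*) [TopologicalSpace X] where
  toFun : Opens X → ℝ≥0∞
  map_bot' : toFun ⊥ = 0
  mono' : ∀ U V : Opens X, U ≤ V → toFun U ≤ toFun V
  modular' : ∀ U V : Opens X, toFun U + toFun V = toFun (U ⊔ V) + toFun (U ⊓ V)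
  map_sSup' : ∀ D : Set (Opens X), D.Nonempty → DirectedOn (· ≤ ·) D →
    toFun (sSup D) = ⨆ U ∈ D, toFun U

namespace ContinuousValuation

variable {X : Type*} [TopologicalSpace X]

instance : CoeFun (ContinuousValuation X) (fun _ => Opens X → ℝ≥0∞) := ⟨toFun⟩

theorem toFun_injective :
    Function.Injective (toFun : ContinuousValuation X → Opens X → ℝ≥0∞) :=
  fun _ _ h => ContinuousValuation.ext h

/-- Valuations are ordered pointwise. -/
instance : PartialOrder (ContinuousValuation X) := PartialOrder.lift toFun toFun_injective

theorem le_def {μ ν : ContinuousValuation X} : μ ≤ ν ↔ ∀ U, μ U ≤ ν U := Iff.rfl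

instance : Zero (ContinuousValuation X) where
  zero :=
    { toFun := fun _ => 0
      map_bot' := rfl
      mono' := fun _ _ _ => le_rfl
      modular' := fun _ _ => rfl
      map_sSup' := fun D _ _ => by simp }

instance : Add (ContinuousValuation X) where
  add μ ν :=
    { toFun := fun U => μ U + ν U
      map_bot' := by simp [μ.map_bot', ν.map_bot']
      mono' := fun U V h => add_le_add (μ.mono' U V h) (ν.mono' U V h)
      modular' := fun U V => by
        rw [add_add_add_comm, μ.modular' U V, ν.modular' U V, add_add_add_comm]
      map_sSup' := fun D hD hd => by
        rw [μ.map_sSup' D hD hd, ν.map_sSup' D hD hd]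
        simp only [iSup_subtype']
        refine ENNReal.iSup_add_iSup fun U V => ?_
        obtain ⟨W, hW, hU, hV⟩ := hd U.1 U.2 V.1 V.2
        exact ⟨⟨W, hW⟩, add_le_add (μ.mono' _ _ hU) (ν.mono' _ _ hV)⟩ }

noncomputable instance : SMul ℝ≥0 (ContinuousValuation X) where
  smul r μ :=
    { toFun := fun U => (r : ℝ≥0∞) * μ U
      map_bot' := by simp [μ.map_bot']
      mono' := fun U V h => mul_le_mul_right (μ.mono' U V h) _
      modular' := fun U V => by rw [← mul_add, μ.modular' U V, mul_add]
      map_sSup' := fun D hD hd => by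
        rw [μ.map_sSup' D hD hd]
        simp only [ENNReal.mul_iSup] }

@[simp] theorem zero_apply (U : Opens X) : (0 : ContinuousValuation X) U = 0 := rfl

@[simp] theorem add_apply (μ ν : ContinuousValuation X) (U : Opens X) :
    (μ + ν) U = μ U + ν U := rfl

@[simp] theorem smul_apply (r : ℝ≥0) (μ : ContinuousValuation X) (U : Opens X) :
    (r • μ) U = (r : ℝ≥0∞) * μ U := rfl

theorem ext_apply {μ ν : ContinuousValuation X} (h : ∀ U, μ U = ν U) : μ = ν :=
  ContinuousValuation.ext (funext h)

instance : AddCommMonoid (ContinuousValuation X) where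
  add_assoc _ _ _ := ext_apply fun _ => by simp [add_assoc]
  zero_add _ := ext_apply fun _ => by simp
  add_zero _ := ext_apply fun _ => by simp
  add_comm _ _ := ext_apply fun _ => by simp [add_comm]
  nsmul := nsmulRec

/-- The real-cone structure: addition and scaling by non-negative reals are pointwise. -/
noncomputable instance : Module ℝ≥0 (ContinuousValuation X) where
  one_smul _ := ext_apply fun _ => by simp
  mul_smul _ _ _ := ext_apply fun _ => by simp [mul_assoc]
  smul_zero _ := ext_apply fun _ => by simp
  smul_add _ _ _ := ext_apply fun _ => by simp [mul_add]
  add_smul _ _ _ := ext_apply fun _ => by simp [add_mul]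
  zero_smul _ := ext_apply fun _ => by simp

/-- The set of continuous valuations of total mass at most `1`. -/
def subprobability (X : Type*) [TopologicalSpace X] : Set (ContinuousValuation X) :=
  {μ | μ ⊤ ≤ 1}

end ContinuousValuation

/-! ### Convex closures in ordered cones -/

section Cones
/-- The convex closure in a real-cone; its elements are the finite convex combinations of
elements of `A`, see `mem_conv_iff`. -/
def conv {C : Type*} [AddCommMonoid C] [Module ℝ≥0 C] (A : Set C) : Set C :=
  convexHull ℝ≥0 A

theorem mem_conv_iff {C : Type*} [AddCommMonoid C] [Module ℝ≥0 C] {A : Set C} {x : C} :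
    x ∈ conv A ↔ ∃ (n : ℕ) (p : Fin n → ℝ≥0) (a : Fin n → C),
      ∑ i, p i = 1 ∧ (∀ i, a i ∈ A) ∧ ∑ i, p i • a i = x := by
  constructor
  · intro hx
    refine convexHull_min (t := {x | ∃ (n : ℕ) (p : Fin n → ℝ≥0) (a : Fin n → C),
      ∑ i, p i = 1 ∧ (∀ i, a i ∈ A) ∧ ∑ i, p i • a i = x}) ?_ ?_ hx
    · intro a ha
      exact ⟨1, fun _ => 1, fun _ => a, by simp, fun _ => ha, by simp⟩
    · rintro _ ⟨n, p, a, hp, ha, rfl⟩ _ ⟨m, q, b, hq, hb, rfl⟩ r s - - hrs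
      refine ⟨n + m, Fin.append (fun i => r * p i) (fun j => s * q j), Fin.append a b, ?_, ?_, ?_⟩
      · simp [Fin.sum_univ_add, ← Finset.mul_sum, hp, hq, hrs]
      · intro i
        refine Fin.addCases (fun i => ?_) (fun j => ?_) i
        · simpa using ha i
        · simpa using hb j
      · simp [Fin.sum_univ_add, Finset.smul_sum, mul_smul]
  · rintro ⟨n, p, a, hp, ha, rfl⟩
    have key : ∀ t : Finset (Fin n), ∑ i ∈ t, p i ≠ 0 →
        ∃ y ∈ conv A, ∑ i ∈ t, p i • a i = (∑ i ∈ t, p i) • y := by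
      intro t
      induction t using Finset.induction_on with
      | empty => simp
      | insert j t hj ih =>
        intro h
        rw [Finset.sum_insert hj] at h
        rw [Finset.sum_insert hj, Finset.sum_insert hj]
        have haj : a j ∈ conv A := subset_convexHull ℝ≥0 A (ha j)
        by_cases h0 : ∑ i ∈ t, p i = 0
        · refine ⟨a j, haj, ?_⟩
          have hz : ∀ i ∈ t, p i = 0 := fun i hi => (Finset.sum_eq_zero_iff.1 h0) i hi
          rw [h0, Finset.sum_eq_zero (fun i hi => by rw [hz i hi, zero_smul])]
          simp
        · obtain ⟨y, hy, hsum⟩ := ih h0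
          set c := ∑ i ∈ t, p i with hc
          refine ⟨(p j / (p j + c)) • a j + (c / (p j + c)) • y,
            (convex_convexHull ℝ≥0 A) haj hy zero_le zero_le ?_, ?_⟩
          · rw [← add_div, div_self h]
          · rw [hsum, smul_add, smul_smul, smul_smul, mul_div_cancel₀ _ h, mul_div_cancel₀ _ h]
    obtain ⟨y, hy, hsum⟩ := key Finset.univ (by rw [hp]; exact one_ne_zero)
    rw [hsum, hp, one_smul]
    exact hy

/-- The set `b(F)`: the intersection of the Scott closure and of the upward closure of the
convex closure of `F`. -/
def biconvexHull {C : Type*} [PartialOrder C] [AddCommMonoid C] [Module ℝ≥0 C] (F : Set C) :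
    Set C :=
  scottClosure (conv F) ∩ (upperClosure (conv F) : Set C)

end Cones

/-! Write `F` as the range of a finite family `a`. Then `conv F` is the image of the standard
simplex, a compact set, under `p ↦ ∑ k, p k • a k`. This map is Lawson continuous: the Scott part
uses that `x` is the directed join of the `r • x` with `r < 1`, and the remaining part that `x ≤ ∑
k, p k • a k` is a closed condition on `p` when the `a k` are finite-valued. Hence `conv F` is
Lawson compact. The same closed conditions, with compactness of the simplex, show that the downward
closure is stable under directed joins, hence Scott closed; the formula for `b(F)` follows. -/

open Filter

/-! ### Continuity of linear combinations in their coefficients. -/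

section Combinations

variable {I : Type*} {X : I → Type*} [∀ i, TopologicalSpace (X i)]

namespace ContinuousValuation

theorem sum_smul_apply {ι Y : Type*} [TopologicalSpace Y] (s : Finset ι) (p : ι → ℝ≥0)
    (a : ι → ContinuousValuation Y) (U : Opens Y) :
    (∑ k ∈ s, p k • a k) U = ∑ k ∈ s, (p k : ℝ≥0∞) * a k U := by
  classical
  induction s using Finset.induction_on with
  | empty => simp
  | insert k s hk ih => rw [Finset.sum_insert hk, Finset.sum_insert hk, add_apply, ih, smul_apply]

theorem pi_sum_smul_apply {ι : Type*} [Fintype ι] (p : ι → ℝ≥0)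
    (a : ι → ∀ i, ContinuousValuation (X i)) (i : I) (U : Opens (X i)) :
    (∑ k, p k • a k) i U = ∑ k, (p k : ℝ≥0∞) * a k i U := by
  rw [Finset.sum_apply, ← sum_smul_apply]
  rfl

theorem pi_sum_smul_mono {ι : Type*} [Fintype ι] {p q : ι → ℝ≥0} (hpq : p ≤ q)
    (a : ι → ∀ i, ContinuousValuation (X i)) : ∑ k, p k • a k ≤ ∑ k, q k • a k := by
  intro i U
  rw [pi_sum_smul_apply, pi_sum_smul_apply]
  gcongr with k
  exact hpq k

/-- Scaling by the non-negative reals below `1` approximates every element from below. -/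
theorem isLUB_smul_Iio_one (x : ∀ i, ContinuousValuation (X i)) :
    IsLUB ((fun r : ℝ≥0 => r • x) '' Iio 1) x := by
  constructor
  · rintro _ ⟨r, hr, rfl⟩ i U
    change (r : ℝ≥0∞) * x i U ≤ x i U
    exact mul_le_of_le_one_left' (by exact_mod_cast (mem_Iio.1 hr).le)
  · intro z hz i U
    refine ENNReal.le_of_forall_nnreal_lt fun t ht => ?_
    by_cases hx : x i U = 0
    · exact absurd ht (by simp [hx])
    -- Any `r` strictly between `t / x i U` and `1` works; being positive, it also handles `x i U =
    -- ⊤`.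
    obtain ⟨r, hr, htr⟩ : ∃ r : ℝ≥0, r < 1 ∧ (t : ℝ≥0∞) ≤ r * x i U := by
      have hlt : (t : ℝ≥0∞) / x i U < 1 := by
        refine (ENNReal.div_lt_iff (Or.inl hx) (Or.inr ENNReal.coe_ne_top)).2 ?_
        rwa [one_mul]
      obtain ⟨r, hr, hr1⟩ := ENNReal.lt_iff_exists_nnreal_btwn.1 hlt
      exact ⟨r, by exact_mod_cast hr1,
        (ENNReal.div_le_iff_le_mul (Or.inl hx) (Or.inr (zero_le.trans_lt hr).ne')).1 hr.le⟩
    exact htr.trans (hz ⟨r, hr, rfl⟩ i U)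

theorem directedOn_smul_Iio_one (x : ∀ i, ContinuousValuation (X i)) :
    DirectedOn (· ≤ ·) ((fun r : ℝ≥0 => r • x) '' Iio 1) := by
  refine DirectedOn.mono_comp (r := (· ≤ ·)) (fun r s hrs i U => ?_)
    (isChain_of_trichotomous (r := (· ≤ ·)) (Iio (1 : ℝ≥0))).directedOn
  change (r : ℝ≥0∞) * x i U ≤ (s : ℝ≥0∞) * x i U
  gcongr

/-- Taking linear combinations of fixed elements is continuous into the Scott topology. -/
theorem continuous_sum_smul_scott {ι : Type*} [Fintype ι]
    (a : ι → ∀ i, ContinuousValuation (X i)) :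
    @Continuous (ι → ℝ≥0) _ _ (Topology.scott _ univ) fun p => ∑ k, p k • a k := by
  let _ : TopologicalSpace (∀ i, ContinuousValuation (X i)) := Topology.scott _ univ
  have : IsScott (∀ i, ContinuousValuation (X i)) univ := ⟨rfl⟩
  refine continuous_def.2 fun S hS => isOpen_iff_mem_nhds.2 fun p hp => ?_
  obtain ⟨hup, hinacc⟩ := IsScott.isOpen_iff_isUpperSet_and_dirSupInaccOn (D := univ).1 hS
  obtain ⟨_, ⟨r, hr, rfl⟩, hrS⟩ := hinacc (mem_univ _) (Set.Nonempty.image _ ⟨0, mem_Iio.2 zero_lt_one⟩)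
    (directedOn_smul_Iio_one _) (isLUB_smul_Iio_one _) hp
  -- Shrinking by `r` leaves room around each nonzero coordinate; a zero coordinate needs none.
  have hev : ∀ᶠ q in 𝓝 p, ∀ k, r * p k ≤ q k := by
    refine eventually_all.2 fun k => ?_
    rcases eq_or_ne (p k) 0 with h0 | h0
    · simp [h0]
    · have hlt : r * p k < p k := mul_lt_of_lt_one_left (pos_iff_ne_zero.2 h0) hr
      exact ((continuous_apply k).tendsto p).eventually (lt_mem_nhds hlt) |>.mono fun _ h => h.le
  filter_upwards [hev] with q hq
  refine hup ?_ hrS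
  simp only [Finset.smul_sum, smul_smul]
  exact pi_sum_smul_mono hq a

/-- The coefficients whose linear combination dominates a given element form a closed set. -/
theorem isClosed_setOf_le_sum_smul {ι : Type*} [Fintype ι]
    {a : ι → ∀ i, ContinuousValuation (X i)} (ha : ∀ k i U, a k i U ≠ ⊤)
    (x : ∀ i, ContinuousValuation (X i)) :
    IsClosed {p : ι → ℝ≥0 | x ≤ ∑ k, p k • a k} := by
  have h : {p : ι → ℝ≥0 | x ≤ ∑ k, p k • a k} =
      ⋂ (i) (U), {p | x i U ≤ ∑ k, (p k : ℝ≥0∞) * a k i U} := by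
    ext p
    simp only [mem_ofPred_eq, mem_iInter, ← pi_sum_smul_apply]
    rfl
  rw [h]
  refine isClosed_iInter fun i => isClosed_iInter fun U => isClosed_le continuous_const ?_
  -- Finiteness matters here: multiplication by `⊤` jumps at `0`.
  exact continuous_finsetSum _ fun k _ =>
    (ENNReal.continuous_mul_const (ha k i U)).comp
      (ENNReal.continuous_coe.comp (continuous_apply k))

/-- Taking linear combinations of fixed finite-valued elements is continuous into the Lawson
topology. -/
theorem continuous_sum_smul_lawson {ι : Type*} [Fintype ι]
    {a : ι → ∀ i, ContinuousValuation (X i)} (ha : ∀ k i U, a k i U ≠ ⊤) :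
    @Continuous (ι → ℝ≥0) _ _ (Topology.lawson _) fun p => ∑ k, p k • a k := by
  refine continuous_inf_rng.2 ⟨continuous_generateFrom_iff.2 ?_, continuous_sum_smul_scott a⟩
  rintro _ ⟨x, rfl⟩
  exact (isClosed_setOf_le_sum_smul ha x).isOpen_compl

end ContinuousValuation

end Combinations

/-! ### Parametrization by the simplex. -/

theorem isCompact_setOf_sum_eq_one (ι : Type*) [Fintype ι] :
    IsCompact {p : ι → ℝ≥0 | ∑ k, p k = 1} := by
  refine (isCompact_Icc (a := (0 : ι → ℝ≥0)) (b := 1)).of_isClosed_subset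
    (isClosed_eq (by fun_prop) continuous_const) fun p hp => ⟨fun _ => zero_le, fun k => ?_⟩
  have hp : ∑ k, p k = 1 := hp
  rw [Pi.one_apply, ← hp]
  exact Finset.single_le_sum (fun _ _ => zero_le) (Finset.mem_univ k)

/-- Fixing the index type bounds the number of coefficients, so a single compact simplex
parametrizes all convex combinations. -/
theorem conv_range_eq_image {C ι : Type*} [AddCommMonoid C] [Module ℝ≥0 C] [Fintype ι]
    (a : ι → C) :
    conv (range a) = (fun p : ι → ℝ≥0 => ∑ k, p k • a k) '' {p | ∑ k, p k = 1} := by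
  classical
  apply Subset.antisymm
  · refine convexHull_min ?_ ?_
    · rintro _ ⟨k, rfl⟩
      exact ⟨Pi.single k 1, by simp, by simp [Pi.single_apply, ite_smul]⟩
    · rintro _ ⟨p, hp, rfl⟩ _ ⟨q, hq, rfl⟩ r s - - hrs
      have hp : ∑ k, p k = 1 := hp
      have hq : ∑ k, q k = 1 := hq
      refine ⟨r • p + s • q, ?_, ?_⟩
      · simp [Finset.sum_add_distrib, ← Finset.mul_sum, hp, hq, hrs]
      · simp [add_smul, Finset.sum_add_distrib, Finset.smul_sum, mul_smul]
  · rintro _ ⟨p, hp, rfl⟩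
    have hp : ∑ k, p k = 1 := hp
    let e := (Fintype.equivFin ι).symm
    refine mem_conv_iff.2 ⟨Fintype.card ι, p ∘ e, a ∘ e, ?_, fun _ => mem_range_self _, ?_⟩
    · rw [← hp]
      exact e.sum_comp p
    · exact e.sum_comp fun k => p k • a k

/-! ### Lawson compactness and Scott closure. -/

section ConvexClosure

variable {I ι : Type*} {X : I → Type*} [∀ i, TopologicalSpace (X i)] [Fintype ι]
  {a : ι → ∀ i, ContinuousValuation (X i)}

theorem isLawsonCompact_conv_range (ha : ∀ k i U, a k i U ≠ ⊤) :
    IsLawsonCompact (conv (range a)) := by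
  let _ : TopologicalSpace (∀ i, ContinuousValuation (X i)) := Topology.lawson _
  rw [conv_range_eq_image]
  exact (isCompact_setOf_sum_eq_one ι).image (ContinuousValuation.continuous_sum_smul_lawson ha)

theorem dirSupClosed_lowerClosure_conv_range (ha : ∀ k i U, a k i U ≠ ⊤) :
    DirSupClosed (lowerClosure (conv (range a)) : Set (∀ i, ContinuousValuation (X i))) := by
  intro D hD hne hdir z hz
  -- `K x` collects the simplex points whose combination dominates `x`. It is compact and antitone
  -- in `x`, so along `D` these sets have a common point, which dominates the join.
  let K : (∀ i, ContinuousValuation (X i)) → Set (ι → ℝ≥0) :=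
    fun x => {p | ∑ k, p k = 1} ∩ {p | x ≤ ∑ k, p k • a k}
  have hcompact : ∀ x, IsCompact (K x) := fun x =>
    (isCompact_setOf_sum_eq_one ι).inter_right
      (ContinuousValuation.isClosed_setOf_le_sum_smul ha x)
  have : Nonempty D := hne.to_subtype
  obtain ⟨p, hp⟩ := IsCompact.nonempty_iInter_of_directed_nonempty_isCompact_isClosed
    (fun d : D => K d)
    (fun d e => by
      obtain ⟨f, hf, hdf, hef⟩ := hdir d d.2 e e.2
      exact ⟨⟨f, hf⟩, fun q hq => ⟨hq.1, hdf.trans hq.2⟩, fun q hq => ⟨hq.1, hef.trans hq.2⟩⟩)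
    (fun d => by
      obtain ⟨y, hy, hdy⟩ := hD d.2
      rw [conv_range_eq_image] at hy
      obtain ⟨q, hq, rfl⟩ := hy
      exact ⟨q, hq, hdy⟩)
    (fun d => hcompact d) (fun d => (hcompact d).isClosed)
  rw [mem_iInter] at hp
  refine ⟨∑ k, p k • a k, ?_, hz.2 fun d hd => (hp ⟨d, hd⟩).2⟩
  rw [conv_range_eq_image]
  exact ⟨p, (hp ⟨_, hne.some_mem⟩).1, rfl⟩

theorem scottClosure_conv_range (ha : ∀ k i U, a k i U ≠ ⊤) :
    scottClosure (conv (range a)) =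
      (lowerClosure (conv (range a)) : Set (∀ i, ContinuousValuation (X i))) := by
  let _ : TopologicalSpace (∀ i, ContinuousValuation (X i)) := Topology.scott _ univ
  have : IsScott (∀ i, ContinuousValuation (X i)) univ := ⟨rfl⟩
  refine Subset.antisymm (closure_minimal subset_lowerClosure ?_)
    IsScott.lowerClosure_subset_closure
  exact IsScott.isClosed_iff_isLowerSet_and_dirSupClosed.2
    ⟨(lowerClosure _).lower, dirSupClosed_lowerClosure_conv_range ha⟩

end ConvexClosure

/-- The convex closure of a finite set of families of subprobability valuations is Lawson compact,
and its Scott closure is its downward closure. The argument is valid for arbitrary topological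
spaces `X i`: only finiteness of `F` and of the masses of its elements is needed. -/
theorem mainTheorem10 {I : Type*} (X : I → Type*)
    [∀ i, PartialOrder (X i)] [∀ i, TopologicalSpace (X i)]
    [∀ i, Topology.IsScott (X i) Set.univ]
    (hcoh : ∀ i, IsCoherentDomain (X i)) (hzero : ∀ i, IsZeroDimensional (X i))
    (F : Set (∀ i, ContinuousValuation (X i))) (hfin : F.Finite)
    (hF : F ⊆ Set.univ.pi fun i => ContinuousValuation.subprobability (X i)) :
    IsLawsonCompact (conv F) ∧
      scottClosure (conv F) = (lowerClosure (conv F) : Set (∀ i, ContinuousValuation (X i))) ∧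
      biconvexHull F =
        (lowerClosure (conv F) : Set (∀ i, ContinuousValuation (X i))) ∩
          (upperClosure (conv F) : Set (∀ i, ContinuousValuation (X i))) := by
  obtain ⟨ι, _, a, rfl⟩ : ∃ (ι : Type _) (_ : Fintype ι) (a : ι → ∀ i, ContinuousValuation (X i)),
      range a = F := ⟨F, hfin.fintype, Subtype.val, Subtype.range_coe⟩
  have ha : ∀ k i U, a k i U ≠ ⊤ := fun k i U =>
    ne_top_of_le_ne_top ENNReal.one_ne_top
      (((a k i).mono' U ⊤ le_top).trans (hF ⟨k, rfl⟩ i (mem_univ i)))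
  have hcl := scottClosure_conv_range ha
  exact ⟨isLawsonCompact_conv_range ha, hcl, by rw [biconvexHull, hcl]⟩
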